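/- Let $J$ be a set and $\mathcal U$ an ultrafilter on $J$. For a set $X$ let ${}^*X=X^J/\mathcal U$ be the ultrapower, which serves as the internal universe over the (standard) universe of all sets: elements of $X$, identified with the classes of constant functions, are called standard; internal subsets of $X$ are elements of ${}^*\mathcal P(X)$; and relations and operations are extended to internal objects as usual. For $x,y\in{}^*\mathbb R$ write $x\simeq y$ if $|x-y|<1/n$ for all standard $n\ge 1$; the shadow $\operatorname{sh}(x)$ of a limited $x\in{}^*\mathbb R$ is the standard real $r$ with $r\simeq x$. Fix a nonstandard (equivalently, unlimited) $w\in{}^*\mathbb N$. For a standard function $f$ with domain $\mathbb N$ let $f(w)$ be its value at $w$; the internal objects of the form $f(w)$ are called $w$-standard. For $n\in\mathbb N$ let $\mathcal T_n=\{i/n : 0\le i\le n\}\subseteq[0,1]$, and let $\Omega=\mathcal T_w$ be the hyperfinite time line, an internal subset of $[0,1]$, with the internal normalized counting measure $\mu(X)=|X|/|\mathcal T_w|$ on internal $X\subseteq\mathcal T_w$. For $f:\mathbb N\to[0,1]$ let $f_w=\{g\in[0,1]^{\mathbb N} : g(w)=f(w)\}$; for a $w$-standard internal $X\subseteq\mathcal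 T_w$ let $[X]=\{f_w : f(w)\in X\}$. Let $\mathcal B$ be the algebra of subsets of $[\Omega]$ consisting of all $[X]$ with $X\subseteq\mathcal T_w$ internal and $w$-standard, and let $m([X])=\operatorname{sh}(\mu(X))$. Let $\overline m$ be the extension of the countably additive $m$ to a measure on the $\sigma$-algebra generated by $\mathcal B$, and let $([\Omega],\widehat{\mathcal B},\widehat m)$ be its completion (the Loeb measure space). For $A\subseteq[0,1]$ put ${}^\bullet A=\{f_w\in[\Omega] : f(w)\simeq c\text{ for some standard }c\in A\}$. Let $\mathcal L=\{A\subseteq[0,1] : {}^\bullet A\in\widehat{\mathcal B}\}$ and $\ell(A)=\widehat m({}^\bullet A)$ for $A\in\mathcal L$. **Theorem.** The triple $([0,1],\mathcal L,\ell)$ is the Lebesgue measure space on $[0,1]$: $\mathcal L$ is exactly the family of Lebesgue measurable subsets of $[0,1]$, and $\ell(A)$ is the Lebesgue measure of $A$ for every $A\in\mathcal L$. -/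

import Mathlib

open Filter MeasureTheory Set
open scoped ENNReal unitInterval

noncomputable section

namespace HyperfiniteLoeb

universe u

variable {J : Type u} {𝒰 : Ultrafilter J} {X Y : Type}

/-! ### The internal universe

The standard universe is the universe of types; every set, function, real number given directly by
a type is standard. The internal universe is an arbitrary ultrapower of the standard one: an
internal object "of type `X`" is an element of `Star 𝒰 X`, a standard object `a : X` is identified
with the class `↑a` of the constant function, and the internal meaning of relations and operations
is the one induced on germs. In particular internal subsets of `X` are elements of
`Star 𝒰 (Set X)`. -/

/-- The ultrapower `*X` of the standard set `X`. -/
abbrev Star (𝒰 : Ultrafilter J) (X : Type) : Type u := Germ (𝒰 : Filter J) X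

/-- An internal object is standard if it is the image of an object of the standard universe. -/
def IsStandard (x : Star 𝒰 X) : Prop := ∃ a : X, x = (a : Star 𝒰 X)

/-- The value `f(w)` at the internal natural number `w` of the standard function `f : ℕ → X`. -/
def valueAt (w : Star 𝒰 ℕ) (f : ℕ → X) : Star 𝒰 X := Germ.map f w

/-- `x` is `w`-standard if `x = f(w)` for a standard function `f` with domain `ℕ`. -/
def IsWStandard (w : Star 𝒰 ℕ) (x : Star 𝒰 X) : Prop := ∃ f : ℕ → X, x = valueAt w f

/-- The internal membership relation. -/
def IMem (x : Star 𝒰 X) (A : Star 𝒰 (Set X)) : Prop := Germ.LiftRel (· ∈ ·) x A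

/-- The internal inclusion relation. -/
def ISubset (A B : Star 𝒰 (Set X)) : Prop := Germ.LiftRel (· ⊆ ·) A B

/-- `x ≃ y`: the distance is less than `1 / n` for every standard `n ≠ 0`. -/
def InfClose (x y : Star 𝒰 ℝ) : Prop :=
  ∀ n : ℕ, n ≠ 0 → |x - y| < ((1 / (n : ℝ) : ℝ) : Star 𝒰 ℝ)

open Classical in
/-- The shadow: the standard real infinitely close to `x` if there is one (i.e. if `x` is limited),
and `+∞` or `-∞`, according to sign, if `x` is unlimited. -/
def shadow (x : Star 𝒰 ℝ) : EReal :=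
  if h : ∃ r : ℝ, InfClose x (r : Star 𝒰 ℝ) then ((h.choose : ℝ) : EReal)
  else if 0 < x then ⊤ else ⊥

/-! ### The hyperfinite time line -/

/-- `𝒯ₙ = {i / n ∣ 0 ≤ i ≤ n}`, as a subset of `O = [0,1]`. -/
def timeGrid (n : ℕ) : Set I := {x | ∃ i : ℕ, i ≤ n ∧ (x : ℝ) = (i : ℝ) / (n : ℝ)}

/-- The hyperfinite time line `Ω = 𝒯_w`, an internal subset of `[0,1]`. -/
def timeLine (w : Star 𝒰 ℕ) : Star 𝒰 (Set I) := valueAt w timeGrid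

/-- The `w`-standard members of the internal algebra `𝒜` of all internal subsets of `𝒯_w`. -/
def IsInternalEvent (w : Star 𝒰 ℕ) (A : Star 𝒰 (Set I)) : Prop :=
  ISubset A (timeLine w) ∧ IsWStandard w A

/-- The internal normalized counting measure `μ(A) = |A| / |𝒯_w|`. -/
def countMeasure (w : Star 𝒰 ℕ) (A : Star 𝒰 (Set I)) : Star 𝒰 ℝ :=
  Germ.map₂ (fun B T : Set I => (B.ncard : ℝ) / (T.ncard : ℝ)) A (timeLine w)

/-! ### Codes -/

/-- Functions `f, g : ℕ → X` represent the same `w`-standard object if `f(w) = g(w)`. -/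
def codeSetoid (w : Star 𝒰 ℕ) (X : Type) : Setoid (ℕ → X) where
  r f g := valueAt w f = valueAt w g
  iseqv := ⟨fun _ => rfl, fun h => h.symm, fun h k => h.trans k⟩

/-- The set `Xᴺ/w` of the classes `f_w = {g ∣ g(w) = f(w)}`. -/
def Code (w : Star 𝒰 ℕ) (X : Type) : Type := Quotient (codeSetoid w X)

/-- The class `f_w`. -/
def toCode (w : Star 𝒰 ℕ) (f : ℕ → X) : Code w X := Quotient.mk (codeSetoid w X) f

/-- The code `[A] = {f_w ∣ f(w) ∈ A}` of an internal set `A ⊆ [0,1]`. -/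
def codeSet (w : Star 𝒰 ℕ) (A : Star 𝒰 (Set I)) : Set (Code w I) :=
  {q | ∃ f : ℕ → I, q = toCode w f ∧ IMem (valueAt w f) A}

/-- The underlying set `[Ω]` of the Loeb space. -/
structure LoebPoint (w : Star 𝒰 ℕ) : Type where
  /-- The point as a class `f_w`. -/
  code : Code w I
  mem : code ∈ codeSet w (timeLine w)

/-- `[A]` as a subset of `[Ω]`, for internal `A ⊆ Ω`. -/
def event (w : Star 𝒰 ℕ) (A : Star 𝒰 (Set I)) : Set (LoebPoint w) := {q | q.code ∈ codeSet w A}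

/-- The algebra `ℬ = {[A] ∣ A ∈ 𝒜 w-standard}` of subsets of `[Ω]`. -/
def loebAlgebra (w : Star 𝒰 ℕ) : Set (Set (LoebPoint w)) :=
  {B | ∃ A, IsInternalEvent w A ∧ B = event w A}

open Classical in
/-- The set function `m` on `ℬ`, with `m([A]) = sh(μ(A))` (see `preLoeb_event`). -/
def preLoeb (w : Star 𝒰 ℕ) (B : Set (LoebPoint w)) : ℝ≥0∞ :=
  if h : ∃ A, IsInternalEvent w A ∧ B = event w A
  then (shadow (countMeasure w h.choose)).toENNReal else 0

/-! ### `ℬ` is an algebra and `m` is a countably additive content on it -/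

lemma exists_trace (w : Star 𝒰 ℕ) : ∃ V : Ultrafilter ℕ,
    (∀ (X Y : Type) (P : X → Y → Prop) (f : ℕ → X) (g : ℕ → Y),
      Germ.LiftRel P (valueAt w f) (valueAt w g) ↔ ∀ᶠ n in (V : Filter ℕ), P (f n) (g n)) ∧
    (∀ (X : Type) (f g : ℕ → X),
      valueAt w f = valueAt w g ↔ ∀ᶠ n in (V : Filter ℕ), f n = g n) ∧
    (∀ (u : ℕ → ℝ) (r : ℝ), InfClose (valueAt w u) (r : Star 𝒰 ℝ) ↔
      Tendsto u (V : Filter ℕ) (nhds r)) ∧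
    (¬ IsStandard w → ∀ k : ℕ, ∀ᶠ n in (V : Filter ℕ), k ≤ n) := by
  induction w using Germ.inductionOn with | h ρ => ?_
  refine ⟨𝒰.map ρ, ?_, ?_, ?_, ?_⟩
  · intro X Y P f g
    rfl
  · intro X f g
    exact Germ.coe_eq
  · intro u r
    have key : ∀ n : ℕ, (|valueAt (ρ : Star 𝒰 ℕ) u - (r : Star 𝒰 ℝ)|
        < ((1 / (n : ℝ) : ℝ) : Star 𝒰 ℝ)) ↔
        ∀ᶠ j in (𝒰 : Filter J), |u (ρ j) - r| < 1 / (n : ℝ) := by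
      intro n
      exact Germ.coe_lt
    unfold InfClose
    simp only [key]
    rw [Metric.tendsto_nhds]
    constructor
    · intro h ε hε
      obtain ⟨n, hn⟩ := exists_nat_one_div_lt hε
      have := h (n + 1) (Nat.succ_ne_zero n)
      refine Filter.Eventually.filter_mono le_rfl (Filter.eventually_map.2 ?_)
      filter_upwards [this] with j hj
      rw [Real.dist_eq]
      push_cast at hj
      exact hj.trans hn
    · intro h n hn
      have := Filter.eventually_map.1 (h (1 / (n : ℝ)) (by positivity))
      filter_upwards [this] with j hj
      rwa [Real.dist_eq] at hj
  · intro hw k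
    by_contra hk
    have hk' : ∀ᶠ j in (𝒰 : Filter J), ρ j < k := by
      have h1 : ¬ ∀ᶠ j in (𝒰 : Filter J), k ≤ ρ j := fun h => hk (Filter.eventually_map.2 h)
      have h2 := Ultrafilter.eventually_not.2 h1
      filter_upwards [h2] with j hj
      omega
    have h3 : ∀ᶠ j in (𝒰 : Filter J), ∃ a ∈ Finset.range k, ρ j = a := by
      filter_upwards [hk'] with j hj
      exact ⟨ρ j, Finset.mem_range.2 hj, rfl⟩
    have h4 : (⋃ a ∈ (Finset.range k : Set ℕ), {j | ρ j = a}) ∈ 𝒰 := by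
      filter_upwards [h3] with j hj
      simpa using hj
    rw [Ultrafilter.finite_biUnion_mem_iff (Finset.finite_toSet _)] at h4
    obtain ⟨a, -, ha⟩ := h4
    exact hw ⟨a, Germ.coe_eq.2 ha⟩

/-- The ultrafilter `U_w` on `ℕ` generated by `w`. -/
def trace (w : Star 𝒰 ℕ) : Ultrafilter ℕ := (exists_trace w).choose

variable {w : Star 𝒰 ℕ}

lemma iMem_iff {f : ℕ → X} {F : ℕ → Set X} :
    IMem (valueAt w f) (valueAt w F) ↔ ∀ᶠ n in (trace w : Filter ℕ), f n ∈ F n :=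
  (exists_trace w).choose_spec.1 X (Set X) (· ∈ ·) f F

lemma iSubset_iff {F G : ℕ → Set X} :
    ISubset (valueAt w F) (valueAt w G) ↔ ∀ᶠ n in (trace w : Filter ℕ), F n ⊆ G n :=
  (exists_trace w).choose_spec.1 (Set X) (Set X) (· ⊆ ·) F G

lemma valueAt_eq_iff {f g : ℕ → X} :
    valueAt w f = valueAt w g ↔ ∀ᶠ n in (trace w : Filter ℕ), f n = g n :=
  (exists_trace w).choose_spec.2.1 X f g

lemma infClose_iff {u : ℕ → ℝ} {r : ℝ} :
    InfClose (valueAt w u) (r : Star 𝒰 ℝ) ↔ Tendsto u (trace w : Filter ℕ) (nhds r) :=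
  (exists_trace w).choose_spec.2.2.1 u r

lemma eventually_ge (hw : ¬ IsStandard w) (k : ℕ) : ∀ᶠ n in (trace w : Filter ℕ), k ≤ n :=
  (exists_trace w).choose_spec.2.2.2 hw k

lemma shadow_eq {u : ℕ → ℝ} {r : ℝ} (h : Tendsto u (trace w : Filter ℕ) (nhds r)) :
    shadow (valueAt w u) = (r : EReal) := by
  have hex : ∃ r : ℝ, InfClose (valueAt w u) (r : Star 𝒰 ℝ) := ⟨r, infClose_iff.2 h⟩
  unfold shadow
  rw [dif_pos hex]
  exact congrArg _ (tendsto_nhds_unique (infClose_iff.1 hex.choose_spec) h)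

lemma timeGrid_finite (n : ℕ) : (timeGrid n).Finite := by
  have h : ((fun i : ℕ => (i : ℝ) / (n : ℝ)) '' (Finset.range (n + 1) : Set ℕ)).Finite :=
    (Finset.finite_toSet _).image _
  refine (h.preimage (f := fun x : I => (x : ℝ)) Subtype.val_injective.injOn).subset ?_
  rintro x ⟨i, hi, hx⟩
  exact ⟨i, by simpa using Nat.lt_succ_of_le hi, hx.symm⟩

lemma mem_event_iff {f : ℕ → I} {hf : toCode w f ∈ codeSet w (timeLine w)} {F : ℕ → Set I} :
    (⟨toCode w f, hf⟩ : LoebPoint w) ∈ event w (valueAt w F) ↔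
      ∀ᶠ n in (trace w : Filter ℕ), f n ∈ F n := by
  rw [← iMem_iff]
  constructor
  · rintro ⟨g, hg, hgF⟩
    have : valueAt w f = valueAt w g := Quotient.exact hg
    rwa [this]
  · intro h
    exact ⟨f, rfl, h⟩

lemma toCode_mem_iff {f : ℕ → I} : toCode w f ∈ codeSet w (timeLine w) ↔
    ∀ᶠ n in (trace w : Filter ℕ), f n ∈ timeGrid n := by
  rw [← iMem_iff]
  constructor
  · rintro ⟨g, hg, hgF⟩
    have : valueAt w f = valueAt w g := Quotient.exact hg
    rwa [this]
  · intro h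
    exact ⟨f, rfl, h⟩

lemma exists_rep (q : LoebPoint w) : ∃ (f : ℕ → I) (hf : toCode w f ∈ codeSet w (timeLine w)),
    q = ⟨toCode w f, hf⟩ := by
  obtain ⟨q, f, rfl, hf⟩ := q
  exact ⟨f, ⟨f, rfl, hf⟩, rfl⟩

lemma mem_loebAlgebra_iff {B : Set (LoebPoint w)} : B ∈ loebAlgebra w ↔
    ∃ F : ℕ → Set I, (∀ n, F n ⊆ timeGrid n) ∧ B = event w (valueAt w F) := by
  constructor
  · rintro ⟨A, ⟨hA, F, rfl⟩, rfl⟩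
    refine ⟨fun n => F n ∩ timeGrid n, fun n => inter_subset_right, ?_⟩
    congr 1
    rw [valueAt_eq_iff]
    filter_upwards [iSubset_iff.1 hA] with n hn
    exact (inter_eq_left.2 hn).symm
  · rintro ⟨F, hF, rfl⟩
    exact ⟨_, ⟨iSubset_iff.2 (Eventually.of_forall hF), F, rfl⟩, rfl⟩

lemma event_subset {F G : ℕ → Set I} (hF : ∀ n, F n ⊆ timeGrid n)
    (h : event w (valueAt w F) ⊆ event w (valueAt w G)) :
    ∀ᶠ n in (trace w : Filter ℕ), F n ⊆ G n := by
  classical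
  by_contra hne
  have hne' := Ultrafilter.eventually_not.2 hne
  let f : ℕ → I := fun n => if h : ∃ x, x ∈ F n ∧ x ∉ G n then h.choose else 0
  have hf : ∀ᶠ n in (trace w : Filter ℕ), f n ∈ F n ∧ f n ∉ G n := by
    filter_upwards [hne'] with n hn
    have hx : ∃ x, x ∈ F n ∧ x ∉ G n := Set.not_subset.1 hn
    simp only [f, dif_pos hx]
    exact hx.choose_spec
  have hmem : toCode w f ∈ codeSet w (timeLine w) :=
    toCode_mem_iff.2 (hf.mono fun n hn => hF n hn.1)
  have h1 : (⟨toCode w f, hmem⟩ : LoebPoint w) ∈ event w (valueAt w F) :=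
    mem_event_iff.2 (hf.mono fun n hn => hn.1)
  have h2 := mem_event_iff.1 (h h1)
  obtain ⟨n, hn1, hn2⟩ := (hf.and h2).exists
  exact hn1.2 hn2

/-- Distinct `w`-standard internal events have distinct codes. -/
lemma event_injective {A B : Star 𝒰 (Set I)} (hA : IsInternalEvent w A) (hB : IsInternalEvent w B)
    (h : event w A = event w B) : A = B := by
  obtain ⟨hA, F, rfl⟩ := hA
  obtain ⟨hB, G, rfl⟩ := hB
  have key : ∀ F G : ℕ → Set I, ISubset (valueAt w F) (timeLine w) →
      event w (valueAt w F) = event w (valueAt w G) →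
      ∀ᶠ n in (trace w : Filter ℕ), F n ⊆ G n := by
    intro F G hF hFG
    have e : valueAt w F = valueAt w (fun n => F n ∩ timeGrid n) := by
      rw [valueAt_eq_iff]
      filter_upwards [iSubset_iff.1 hF] with n hn
      exact (inter_eq_left.2 hn).symm
    have := event_subset (w := w) (F := fun n => F n ∩ timeGrid n) (G := G)
      (fun n => inter_subset_right) (by rw [← e, hFG])
    filter_upwards [this, iSubset_iff.1 hF] with n h1 h2 x hx
    exact h1 ⟨hx, h2 hx⟩
  rw [valueAt_eq_iff]
  filter_upwards [key F G hA h, key G F hB h.symm] with n h1 h2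
  exact Subset.antisymm h1 h2

/-- `m([A]) = sh(μ(A))`. -/
lemma preLoeb_event {A : Star 𝒰 (Set I)} (hA : IsInternalEvent w A) :
    preLoeb w (event w A) = (shadow (countMeasure w A)).toENNReal := by
  have h : ∃ A', IsInternalEvent w A' ∧ event w A = event w A' := ⟨A, hA, rfl⟩
  unfold preLoeb
  rw [dif_pos h]
  rw [← event_injective hA h.choose_spec.1 h.choose_spec.2]

lemma countMeasure_valueAt (F : ℕ → Set I) : countMeasure w (valueAt w F) =
    valueAt w (fun n => ((F n).ncard : ℝ) / ((timeGrid n).ncard : ℝ)) := by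
  induction w using Germ.inductionOn with | h ρ => ?_
  rfl

lemma exists_limit {F : ℕ → Set I} (hF : ∀ n, F n ⊆ timeGrid n) :
    ∃ r : ℝ, 0 ≤ r ∧ Tendsto (fun n => ((F n).ncard : ℝ) / ((timeGrid n).ncard : ℝ))
      (trace w : Filter ℕ) (nhds r) := by
  have hmem : ∀ n, ((F n).ncard : ℝ) / ((timeGrid n).ncard : ℝ) ∈ Icc (0 : ℝ) 1 := fun n =>
    ⟨by positivity, div_le_one_of_le₀
      (by exact_mod_cast Set.ncard_le_ncard (hF n) (timeGrid_finite n)) (by positivity)⟩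
  have hle : (((trace w).map
      (fun n => ((F n).ncard : ℝ) / ((timeGrid n).ncard : ℝ)) : Ultrafilter ℝ) : Filter ℝ)
      ≤ 𝓟 (Icc (0 : ℝ) 1) :=
    le_principal_iff.2 (Eventually.of_forall hmem : ∀ᶠ n in (trace w : Filter ℕ), _)
  obtain ⟨r, hr, h⟩ := (isCompact_Icc (a := (0 : ℝ)) (b := 1)).ultrafilter_le_nhds _ hle
  exact ⟨r, hr.1, h⟩

lemma preLoeb_eq {F : ℕ → Set I} (hF : ∀ n, F n ⊆ timeGrid n) {r : ℝ}
    (hr : Tendsto (fun n => ((F n).ncard : ℝ) / ((timeGrid n).ncard : ℝ))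
      (trace w : Filter ℕ) (nhds r)) :
    preLoeb w (event w (valueAt w F)) = ENNReal.ofReal r := by
  rw [preLoeb_event ⟨iSubset_iff.2 (Eventually.of_forall hF), F, rfl⟩, countMeasure_valueAt,
    shadow_eq hr, EReal.toENNReal_of_ne_top (EReal.coe_ne_top r), EReal.toReal_coe]

lemma event_union (F G : ℕ → Set I) :
    event w (valueAt w F) ∪ event w (valueAt w G) = event w (valueAt w fun n => F n ∪ G n) := by
  ext q
  obtain ⟨f, hf, rfl⟩ := exists_rep q
  simp only [mem_union, mem_event_iff]
  exact Ultrafilter.eventually_or.symm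

lemma event_compl (F : ℕ → Set I) :
    (event w (valueAt w F))ᶜ = event w (valueAt w fun n => timeGrid n \ F n) := by
  ext q
  obtain ⟨f, hf, rfl⟩ := exists_rep q
  simp only [mem_compl_iff, mem_event_iff]
  rw [← Ultrafilter.eventually_not]
  constructor
  · intro h
    filter_upwards [h, toCode_mem_iff.1 hf] with n h1 h2
    exact ⟨h2, h1⟩
  · intro h
    exact h.mono fun n hn => hn.2

lemma event_empty : event w (valueAt w fun _ => (∅ : Set I)) = ∅ := by
  ext q
  obtain ⟨f, hf, rfl⟩ := exists_rep q
  simp [mem_event_iff, (trace w).neBot.ne]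

lemma isSetAlgebra_loebAlgebra (w : Star 𝒰 ℕ) : IsSetAlgebra (loebAlgebra w) where
  empty_mem := mem_loebAlgebra_iff.2 ⟨fun _ => ∅, fun _ => empty_subset _, event_empty.symm⟩
  compl_mem := by
    intro s hs
    obtain ⟨F, hF, rfl⟩ := mem_loebAlgebra_iff.1 hs
    exact mem_loebAlgebra_iff.2 ⟨_, fun n => sdiff_subset, event_compl F⟩
  union_mem := by
    intro s t hs ht
    obtain ⟨F, hF, rfl⟩ := mem_loebAlgebra_iff.1 hs
    obtain ⟨G, hG, rfl⟩ := mem_loebAlgebra_iff.1 ht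
    exact mem_loebAlgebra_iff.2 ⟨_, fun n => union_subset (hF n) (hG n), event_union F G⟩

lemma preLoeb_empty : preLoeb w (∅ : Set (LoebPoint w)) = 0 := by
  rw [← event_empty, preLoeb_eq (r := 0) (fun _ => empty_subset _) (by simp)]
  simp

lemma preLoeb_union {s t : Set (LoebPoint w)} (hs : s ∈ loebAlgebra w) (ht : t ∈ loebAlgebra w)
    (hst : Disjoint s t) : preLoeb w (s ∪ t) = preLoeb w s + preLoeb w t := by
  obtain ⟨F, hF, rfl⟩ := mem_loebAlgebra_iff.1 hs
  obtain ⟨G, hG, rfl⟩ := mem_loebAlgebra_iff.1 ht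
  obtain ⟨r, hr0, hr⟩ := exists_limit (w := w) hF
  obtain ⟨r', hr0', hr'⟩ := exists_limit (w := w) hG
  have hd : ∀ᶠ n in (trace w : Filter ℕ), F n ⊆ timeGrid n \ G n := by
    refine event_subset hF ?_
    rw [← event_compl]
    exact hst.subset_compl_right
  rw [event_union, preLoeb_eq hF hr, preLoeb_eq hG hr', ← ENNReal.ofReal_add hr0 hr0']
  refine preLoeb_eq (fun n => union_subset (hF n) (hG n)) ((hr.add hr').congr' ?_)
  filter_upwards [hd] with n hn
  rw [Set.ncard_union_eq (Set.disjoint_left.2 fun x hx => (hn hx).2)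
    ((timeGrid_finite n).subset (hF n)) ((timeGrid_finite n).subset (hG n))]
  push_cast
  rw [add_div]

/-- The finitely additive measure `m` on `ℬ`. -/
def loebContent (w : Star 𝒰 ℕ) : AddContent ℝ≥0∞ (loebAlgebra w) :=
  IsSetRing.addContent_of_union (preLoeb w) (isSetAlgebra_loebAlgebra w).isSetRing preLoeb_empty
    preLoeb_union

/-- A countable cover of `[A]` by sets in `ℬ` has a finite subcover. -/
lemma exists_finite_subcover (hw : ¬ IsStandard w) {F : ℕ → Set I} {G : ℕ → ℕ → Set I}
    (hF : ∀ n, F n ⊆ timeGrid n)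
    (hcov : event w (valueAt w F) ⊆ ⋃ k, event w (valueAt w (G k))) :
    ∃ K : ℕ, event w (valueAt w F) ⊆ ⋃ k ∈ Finset.range K, event w (valueAt w (G k)) := by
  classical
  by_contra! hno
  have hne : ∀ K : ℕ, ∀ᶠ n in (trace w : Filter ℕ), ∃ x ∈ F n, ∀ k < K, x ∉ G k n := by
    intro K
    obtain ⟨q, hqF, hqG⟩ := Set.not_subset.1 (hno K)
    obtain ⟨f, hf, rfl⟩ := exists_rep q
    have h1 := mem_event_iff.1 hqF
    have h2 : ∀ k ∈ Finset.range K, ∀ᶠ n in (trace w : Filter ℕ), f n ∉ G k n := by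
      intro k hk
      rw [Ultrafilter.eventually_not, ← mem_event_iff (hf := hf)]
      intro hmem
      exact hqG (mem_biUnion hk hmem)
    have h3 := (Filter.eventually_all_finset _).2 h2
    filter_upwards [h1, h3] with n hn1 hn3
    exact ⟨f n, hn1, fun k hk => hn3 k (Finset.mem_range.2 hk)⟩
  let P : ℕ → ℕ → Prop := fun n K => ∃ x ∈ F n, ∀ k < K, x ∉ G k n
  let g : ℕ → I := fun n =>
    if h : P n (Nat.findGreatest (P n) n) then h.choose else 0
  have hg : ∀ K : ℕ, ∀ᶠ n in (trace w : Filter ℕ), g n ∈ F n ∧ ∀ k < K, g n ∉ G k n := by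
    intro K
    filter_upwards [hne K, eventually_ge hw K] with n hn hKn
    have h1 : P n (Nat.findGreatest (P n) n) := Nat.findGreatest_spec hKn hn
    have h2 : K ≤ Nat.findGreatest (P n) n := Nat.le_findGreatest hKn hn
    simp only [g, dif_pos h1]
    exact ⟨h1.choose_spec.1, fun k hk => h1.choose_spec.2 k (hk.trans_le h2)⟩
  have hmem : toCode w g ∈ codeSet w (timeLine w) :=
    toCode_mem_iff.2 ((hg 0).mono fun n hn => hF n hn.1)
  have hgF : (⟨toCode w g, hmem⟩ : LoebPoint w) ∈ event w (valueAt w F) :=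
    mem_event_iff.2 ((hg 0).mono fun n hn => hn.1)
  obtain ⟨k, hk⟩ := mem_iUnion.1 (hcov hgF)
  obtain ⟨n, hn1, hn2⟩ := ((hg (k + 1)).and (mem_event_iff.1 hk)).exists
  exact hn1.2 k (Nat.lt_succ_self k) hn2

lemma loebContent_isSigmaSubadditive (hw : ¬ IsStandard w) :
    (loebContent w).IsSigmaSubadditive := by
  intro f hf hU
  have hring := (isSetAlgebra_loebAlgebra w).isSetRing
  choose G hG hfG using fun k => mem_loebAlgebra_iff.1 (hf k)
  obtain ⟨F, hF, hUF⟩ := mem_loebAlgebra_iff.1 hU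
  obtain ⟨K, hK⟩ := exists_finite_subcover (G := G) hw hF
    (by rw [← hUF]; exact iUnion_mono fun k => (hfG k).subset)
  have e : (⋃ i, f i) = ⋃ k ∈ Finset.range K, f k := by
    refine Subset.antisymm ?_ (iUnion₂_subset fun k _ => subset_iUnion f k)
    rw [hUF]
    simp only [hfG]
    exact hK
  rw [e]
  exact (addContent_biUnion_le hring fun n _ => hf n).trans (ENNReal.sum_le_tsum _)

/-! ### The Loeb measure -/

/-- The `σ`-algebra on `[Ω]` generated by `ℬ`. -/
instance loebMeasurableSpace (w : Star 𝒰 ℕ) : MeasurableSpace (LoebPoint w) :=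
  MeasurableSpace.generateFrom (loebAlgebra w)

/-- The extension of `m` to a `σ`-additive measure on the `σ`-algebra generated by `ℬ`. -/
def baseLoebMeasure (w : Star 𝒰 ℕ) (hw : ¬ IsStandard w) : Measure (LoebPoint w) :=
  (loebContent w).measure (isSetAlgebra_loebAlgebra w).isSetRing.isSetSemiring le_rfl
    (loebContent_isSigmaSubadditive hw)

lemma baseLoebMeasure_event (hw : ¬ IsStandard w) {A : Star 𝒰 (Set I)}
    (hA : IsInternalEvent w A) :
    baseLoebMeasure w hw (event w A) = (shadow (countMeasure w A)).toENNReal :=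
  ((loebContent w).measure_eq (isSetAlgebra_loebAlgebra w).isSetRing.isSetSemiring rfl
    (loebContent_isSigmaSubadditive hw) ⟨A, hA, rfl⟩).trans (preLoeb_event hA)

/-- The Loeb `σ`-algebra: the sets measurable for the completion of `baseLoebMeasure`. -/
def loebSets (w : Star 𝒰 ℕ) (hw : ¬ IsStandard w) : Set (Set (LoebPoint w)) :=
  {E | NullMeasurableSet E (baseLoebMeasure w hw)}

/-- The Loeb measure: the completion of `baseLoebMeasure`. -/
def loebMeasure (w : Star 𝒰 ℕ) (hw : ¬ IsStandard w) :
    Measure (NullMeasurableSpace (LoebPoint w) (baseLoebMeasure w hw)) :=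
  (baseLoebMeasure w hw).completion

/-! ### The triple `([0,1], 𝓛, ℓ)` -/

/-- `•A = {f_w ∈ [Ω] ∣ f(w) ≃ c for some standard c ∈ A}`. -/
def shadowPreimage (w : Star 𝒰 ℕ) (A : Set ℝ) : Set (LoebPoint w) :=
  {q | ∃ f : ℕ → I, q.code = toCode w f ∧
    ∃ c ∈ A, InfClose (valueAt w fun n => (f n : ℝ)) (c : Star 𝒰 ℝ)}

/-- `𝓛`: the sets `A ⊆ [0,1]` for which `•A` is Loeb measurable. -/
def shadowSets (w : Star 𝒰 ℕ) (hw : ¬ IsStandard w) : Set (Set ℝ) :=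
  {A | A ⊆ Icc 0 1 ∧ shadowPreimage w A ∈ loebSets w hw}

/-- `ℓ(A)`: the Loeb measure of `•A`. -/
def shadowMeasure (w : Star 𝒰 ℕ) (hw : ¬ IsStandard w) (A : Set ℝ) : ℝ≥0∞ :=
  loebMeasure w hw (shadowPreimage w A)

end HyperfiniteLoeb

end

open Filter MeasureTheory Set
open scoped ENNReal unitInterval

noncomputable section

namespace HyperfiniteLoeb

universe u

variable {J : Type u} {𝒰 : Ultrafilter J} {w : Star 𝒰 ℕ}

/-! ### The standard part map `[Ω] → [0,1]` -/

/-! Every point of `[Ω]` is infinitely close to exactly one standard real in `[0,1]`, so `•A` is the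
preimage of `A` under the standard part map, and everything reduces to two facts about that map.

It pushes the Loeb measure forward to Lebesgue measure on `[0,1]`
(`measurePreserving_standardPart`): a fraction `(⌊bn⌋ + 1) / (n + 1)` of the grid lies in `[0,b]`,
and this tends to `b`. Hence preimages of Lebesgue measurable sets are Loeb measurable, with the
right measure.

The converse needs more, since a measurable preimage does not in general force a measurable set. A
Loeb measurable set is filled, up to measure zero, by countable intersections of sets in `ℬ`
(`exists_iInter_subset`), and countable compactness of `ℬ` makes the standard part image of such an
intersection closed (`isClosed_image_standardPart`). Applied to `•A` and to its complement, this
traps `A` between two Borel sets whose difference is null. -/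

/-- Compactness of `[0,1]` makes a representing sequence converge along the ultrafilter `trace w`;
two representatives agree on a set of that ultrafilter, so they share the limit. -/
lemma exists_standardPart (q : LoebPoint w) : ∃ r : ℝ, r ∈ Icc (0 : ℝ) 1 ∧
    ∀ f : ℕ → I, q.code = toCode w f →
      Tendsto (fun n => (f n : ℝ)) (trace w : Filter ℕ) (nhds r) := by
  obtain ⟨f, hf, rfl⟩ := exists_rep q
  have hle : (((trace w).map (fun n => (f n : ℝ)) : Ultrafilter ℝ) : Filter ℝ)
      ≤ 𝓟 (Icc (0 : ℝ) 1) :=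
    le_principal_iff.2 (Eventually.of_forall fun n => (f n).2 :
      ∀ᶠ n in (trace w : Filter ℕ), (f n : ℝ) ∈ Icc (0 : ℝ) 1)
  obtain ⟨r, hr, h⟩ := (isCompact_Icc (a := (0 : ℝ)) (b := 1)).ultrafilter_le_nhds _ hle
  refine ⟨r, hr, fun g hg => ?_⟩
  have hfg : valueAt w f = valueAt w g := Quotient.exact hg
  refine Tendsto.congr' ?_ h
  filter_upwards [valueAt_eq_iff.1 hfg] with n hn
  rw [hn]

/-- The standard part of a point `f_w` of `[Ω]`: the shadow of `f(w)`. -/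
def standardPart (q : LoebPoint w) : ℝ := (exists_standardPart q).choose

lemma standardPart_mem_Icc (q : LoebPoint w) : standardPart q ∈ Icc (0 : ℝ) 1 :=
  (exists_standardPart q).choose_spec.1

lemma tendsto_standardPart {q : LoebPoint w} {f : ℕ → I} (h : q.code = toCode w f) :
    Tendsto (fun n => (f n : ℝ)) (trace w : Filter ℕ) (nhds (standardPart q)) :=
  (exists_standardPart q).choose_spec.2 f h

lemma shadowPreimage_eq_preimage (A : Set ℝ) :
    shadowPreimage w A = standardPart (w := w) ⁻¹' A := by
  ext q
  constructor
  · rintro ⟨f, hf, c, hc, hfc⟩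
    have := tendsto_nhds_unique (tendsto_standardPart hf) (infClose_iff.1 hfc)
    rwa [mem_preimage, this]
  · intro hq
    obtain ⟨f, hf, rfl⟩ := exists_rep q
    exact ⟨f, rfl, _, hq, infClose_iff.2 (tendsto_standardPart rfl)⟩

/-- The code of the internal set of all time instants in the set `S` of standard reals. -/
def gridEvent (w : Star 𝒰 ℕ) (S : Set ℝ) : Set (LoebPoint w) :=
  event w (valueAt w fun n => timeGrid n ∩ Subtype.val ⁻¹' S)

lemma gridEvent_mem_loebAlgebra (S : Set ℝ) : gridEvent w S ∈ loebAlgebra w :=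
  mem_loebAlgebra_iff.2 ⟨_, fun _ => inter_subset_left, rfl⟩

lemma mem_gridEvent_iff {S : Set ℝ} {f : ℕ → I} {hf : toCode w f ∈ codeSet w (timeLine w)} :
    (⟨toCode w f, hf⟩ : LoebPoint w) ∈ gridEvent w S ↔
      ∀ᶠ n in (trace w : Filter ℕ), (f n : ℝ) ∈ S := by
  rw [gridEvent, mem_event_iff]
  exact ⟨fun h => h.mono fun n hn => hn.2, fun h => (toCode_mem_iff.1 hf).and h⟩

lemma gridEvent_mono {S T : Set ℝ} (h : S ⊆ T) : gridEvent w S ⊆ gridEvent w T := by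
  intro q hq
  obtain ⟨f, hf, rfl⟩ := exists_rep q
  exact mem_gridEvent_iff.2 ((mem_gridEvent_iff.1 hq).mono fun n hn => h hn)

/-- An infinitesimal shift cannot leave an open set, though it can cross the boundary of an
arbitrary one. This and the dual statement for closed sets are the only links used between grid
events and standard parts. -/
lemma mem_gridEvent_of_isOpen {S : Set ℝ} (hS : IsOpen S) {q : LoebPoint w}
    (hq : standardPart q ∈ S) : q ∈ gridEvent w S := by
  obtain ⟨f, hf, rfl⟩ := exists_rep q
  exact mem_gridEvent_iff.2 ((tendsto_standardPart rfl).eventually (hS.mem_nhds hq))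

lemma standardPart_mem_of_isClosed {S : Set ℝ} (hS : IsClosed S) {q : LoebPoint w}
    (hq : q ∈ gridEvent w S) : standardPart q ∈ S := by
  obtain ⟨f, hf, rfl⟩ := exists_rep q
  exact hS.mem_of_tendsto (tendsto_standardPart rfl) (mem_gridEvent_iff.1 hq)

lemma measurableSet_of_mem_loebAlgebra {B : Set (LoebPoint w)} (hB : B ∈ loebAlgebra w) :
    MeasurableSet B :=
  MeasurableSpace.measurableSet_generateFrom hB

lemma measurable_standardPart : Measurable (standardPart (w := w)) := by
  refine measurable_of_Iic fun a => ?_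
  -- The margin `1 / (k + 1)` absorbs the infinitesimal by which a point may exceed its standard
  -- part.
  have e : standardPart (w := w) ⁻¹' Iic a =
      ⋂ k : ℕ, gridEvent w (Iic (a + 1 / ((k : ℝ) + 1))) := by
    ext q
    rw [mem_iInter]
    constructor
    · intro hq k
      have hk : (0 : ℝ) < 1 / ((k : ℝ) + 1) := Nat.one_div_pos_of_nat
      have h := mem_gridEvent_of_isOpen (S := Iio (a + 1 / ((k : ℝ) + 1))) isOpen_Iio
        (hq.trans_lt (lt_add_of_pos_right a hk) : standardPart q < _)
      exact gridEvent_mono Iio_subset_Iic_self h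
    · intro hq
      change standardPart q ≤ a
      refine le_of_forall_pos_le_add fun ε hε => ?_
      obtain ⟨k, hk⟩ := exists_nat_one_div_lt hε
      have : standardPart q ≤ a + 1 / ((k : ℝ) + 1) :=
        standardPart_mem_of_isClosed isClosed_Iic (hq k)
      linarith
  rw [e]
  exact MeasurableSet.iInter fun k =>
    measurableSet_of_mem_loebAlgebra (gridEvent_mem_loebAlgebra _)

/-! ### The distribution of the standard part -/

lemma ncard_timeGrid_inter_Iic {n : ℕ} (hn : 0 < n) {b : ℝ} (hb0 : 0 ≤ b) (hb1 : b ≤ 1) :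
    (timeGrid n ∩ Subtype.val ⁻¹' Iic b).ncard = ⌊b * n⌋₊ + 1 := by
  have hn' : (0 : ℝ) < n := by exact_mod_cast hn
  have e : (Subtype.val '' (timeGrid n ∩ Subtype.val ⁻¹' Iic b) : Set ℝ) =
      (fun i : ℕ => (i : ℝ) / n) '' (Finset.range (⌊b * n⌋₊ + 1) : Set ℕ) := by
    ext x
    constructor
    · rintro ⟨y, ⟨⟨i, hi, hy⟩, hyb⟩, rfl⟩
      refine ⟨i, ?_, hy.symm⟩
      have hib : (i : ℝ) / n ≤ b := hy ▸ hyb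
      have : i ≤ ⌊b * n⌋₊ := Nat.le_floor ((div_le_iff₀ hn').1 hib)
      simpa using Nat.lt_succ_of_le this
    · rintro ⟨i, hi, rfl⟩
      have hi' : i ≤ ⌊b * n⌋₊ := Nat.lt_succ_iff.1 (by simpa using hi)
      have hib : (i : ℝ) / n ≤ b :=
        (div_le_iff₀ hn').2 ((Nat.le_floor_iff (by positivity)).1 hi')
      -- Here `b ≤ 1` is needed: it keeps every index up to `⌊b * n⌋₊` on the grid.
      have hin : i ≤ n := by
        have := (div_le_iff₀ hn').1 (hib.trans hb1)
        rw [one_mul] at this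
        exact_mod_cast this
      exact ⟨⟨(i : ℝ) / n, by positivity, hib.trans hb1⟩, ⟨⟨i, hin, rfl⟩, hib⟩, rfl⟩
  rw [← Set.ncard_image_of_injective _ Subtype.val_injective, e,
    Set.ncard_image_of_injective _ fun i j hij => ?_, Set.ncard_coe_finset, Finset.card_range]
  exact_mod_cast (div_left_inj' hn'.ne').1 hij

lemma ncard_timeGrid {n : ℕ} (hn : 0 < n) : (timeGrid n).ncard = n + 1 := by
  have h := ncard_timeGrid_inter_Iic hn zero_le_one le_rfl
  rw [one_mul, Nat.floor_natCast, inter_eq_left.2] at h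
  · exact h
  · exact fun x _ => x.2.2

lemma tendsto_floor_mul_add_one_div {b : ℝ} (hb : 0 ≤ b) :
    Tendsto (fun n : ℕ => ((⌊b * n⌋₊ : ℝ) + 1) / ((n : ℝ) + 1)) atTop (nhds b) := by
  have h1 := (tendsto_nat_floor_mul_div_atTop hb).comp tendsto_natCast_atTop_atTop
  have h2 : Tendsto (fun n : ℕ => 1 / (n : ℝ)) atTop (nhds 0) :=
    tendsto_one_div_atTop_nhds_zero_nat
  -- Numerator and denominator have been divided by `n`.
  have h3 := (h1.add h2).div (h2.const_add 1) (by norm_num)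
  rw [add_zero, add_zero, div_one] at h3
  refine h3.congr' ?_
  filter_upwards [eventually_gt_atTop 0] with n hn
  have hn' : (0 : ℝ) < n := by exact_mod_cast hn
  simp only [Function.comp, Pi.div_apply]
  field_simp

/-- Since `w` is unlimited, ordinary limits of sequences are also limits along `trace w`, hence
shadows of values at `w`. -/
lemma trace_le_atTop (hw : ¬ IsStandard w) : (trace w : Filter ℕ) ≤ atTop :=
  fun s hs => by
    obtain ⟨k, hk⟩ := mem_atTop_sets.1 hs
    exact (eventually_ge hw k).mono hk

lemma baseLoebMeasure_gridEvent_Iic (hw : ¬ IsStandard w) {b : ℝ} (hb0 : 0 ≤ b) (hb1 : b ≤ 1) :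
    baseLoebMeasure w hw (gridEvent w (Iic b)) = ENNReal.ofReal b := by
  have hsub : ∀ n, timeGrid n ∩ Subtype.val ⁻¹' Iic b ⊆ timeGrid n := fun n => inter_subset_left
  have hA : IsInternalEvent w (valueAt w fun n => timeGrid n ∩ Subtype.val ⁻¹' Iic b) :=
    ⟨iSubset_iff.2 (Eventually.of_forall hsub), _, rfl⟩
  rw [gridEvent, baseLoebMeasure_event hw hA, ← preLoeb_event hA]
  refine preLoeb_eq hsub
    (((tendsto_floor_mul_add_one_div hb0).mono_left (trace_le_atTop hw)).congr' ?_)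
  filter_upwards [eventually_ge hw 1] with n hn
  rw [ncard_timeGrid_inter_Iic hn hb0 hb1, ncard_timeGrid hn]
  push_cast
  rfl

lemma baseLoebMeasure_univ (hw : ¬ IsStandard w) : baseLoebMeasure w hw univ = 1 := by
  have e : gridEvent w (Iic 1) = univ := by
    refine eq_univ_of_forall fun q => ?_
    obtain ⟨f, hf, rfl⟩ := exists_rep q
    exact mem_gridEvent_iff.2 (Eventually.of_forall fun n => (f n).2.2)
  rw [← e, baseLoebMeasure_gridEvent_Iic hw zero_le_one le_rfl, ENNReal.ofReal_one]

instance isProbabilityMeasure_baseLoebMeasure (hw : ¬ IsStandard w) :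
    IsProbabilityMeasure (baseLoebMeasure w hw) :=
  ⟨baseLoebMeasure_univ hw⟩

lemma baseLoebMeasure_standardPart_Iic (hw : ¬ IsStandard w) {a : ℝ} (ha0 : 0 ≤ a) (ha1 : a < 1) :
    baseLoebMeasure w hw (standardPart ⁻¹' Iic a) = ENNReal.ofReal a := by
  refine le_antisymm ?_ ?_
  · have hlim : Tendsto ENNReal.ofReal (nhdsWithin a (Ioi a)) (nhds (ENNReal.ofReal a)) :=
      (ENNReal.continuous_ofReal.tendsto a).mono_left nhdsWithin_le_nhds
    refine ge_of_tendsto hlim ?_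
    -- The upper bound comes from grid events at `b` decreasing to `a`; `a < 1` leaves room to keep
    -- `b < 1`, where the counting formula applies.
    filter_upwards [Ioo_mem_nhdsGT ha1] with b hb
    rw [← baseLoebMeasure_gridEvent_Iic hw (ha0.trans hb.1.le) hb.2.le]
    refine measure_mono fun q hq => ?_
    have h := mem_gridEvent_of_isOpen (S := Iio b) isOpen_Iio
      (lt_of_le_of_lt hq hb.1 : standardPart q < b)
    exact gridEvent_mono Iio_subset_Iic_self h
  · rw [← baseLoebMeasure_gridEvent_Iic hw ha0 ha1.le]
    exact measure_mono fun q hq => standardPart_mem_of_isClosed isClosed_Iic hq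

/-- The standard part of a random point of the hyperfinite time line is uniform on `[0,1]`. -/
lemma measurePreserving_standardPart (hw : ¬ IsStandard w) :
    MeasurePreserving standardPart (baseLoebMeasure w hw) (volume.restrict (Icc (0 : ℝ) 1)) := by
  refine ⟨measurable_standardPart, ?_⟩
  have := Measure.isFiniteMeasure_map (baseLoebMeasure w hw) standardPart
  refine Measure.ext_of_Iic _ _ fun a => ?_
  rw [Measure.map_apply measurable_standardPart measurableSet_Iic,
    Measure.restrict_apply measurableSet_Iic]
  rcases lt_or_ge a 0 with ha | ha
  · have e1 : standardPart (w := w) ⁻¹' Iic a = ∅ :=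
      eq_empty_of_forall_notMem fun q hq =>
        absurd ((standardPart_mem_Icc q).1.trans hq) (not_le.2 ha)
    have e2 : Iic a ∩ Icc (0 : ℝ) 1 = ∅ :=
      eq_empty_of_forall_notMem fun x hx => absurd (hx.2.1.trans hx.1) (not_le.2 ha)
    rw [e1, e2, measure_empty, measure_empty]
  rcases lt_or_ge a 1 with ha1 | ha1
  · have e : Iic a ∩ Icc (0 : ℝ) 1 = Icc 0 a :=
      Set.ext fun x => ⟨fun hx => ⟨hx.2.1, hx.1⟩, fun hx => ⟨hx.2, hx.1, hx.2.trans ha1.le⟩⟩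
    rw [baseLoebMeasure_standardPart_Iic hw ha ha1, e, Real.volume_Icc, sub_zero]
  · have e1 : standardPart (w := w) ⁻¹' Iic a = univ :=
      eq_univ_of_forall fun q => (standardPart_mem_Icc q).2.trans ha1
    have e2 : Iic a ∩ Icc (0 : ℝ) 1 = Icc 0 1 := inter_eq_right.2 fun x hx => hx.2.trans ha1
    rw [e1, e2, measure_univ, Real.volume_Icc, sub_zero, ENNReal.ofReal_one]

/-! ### Inner regularity and compactness -/

/-- A set that is measurable for the measure extending `m` is covered by countably many sets in
`ℬ` whose union has almost the same measure. -/
lemma exists_cover (hw : ¬ IsStandard w) {E : Set (LoebPoint w)} (hE : MeasurableSet E)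
    {ε : ℝ≥0∞} (hε : ε ≠ 0) : ∃ B : ℕ → Set (LoebPoint w), (∀ k, B k ∈ loebAlgebra w) ∧
      E ⊆ ⋃ k, B k ∧ baseLoebMeasure w hw (⋃ k, B k) ≤ baseLoebMeasure w hw E + ε := by
  have hS := (isSetAlgebra_loebAlgebra w).isSetRing.isSetSemiring
  have hlt : baseLoebMeasure w hw E < baseLoebMeasure w hw E + ε :=
    ENNReal.lt_add_right (measure_ne_top _ _) hε
  have e : baseLoebMeasure w hw E = ⨅ (t : ℕ → Set (LoebPoint w)) (_ : ∀ i, t i ∈ loebAlgebra w)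
      (_ : E ⊆ ⋃ i, t i), ∑' i, extend (fun x (_ : x ∈ loebAlgebra w) => loebContent w x) (t i) := by
    -- All generated sets are Carathéodory measurable, so on `E` the measure is the induced outer
    -- measure, an infimum over covers from `ℬ`.
    have hm : loebMeasurableSpace w ≤
        (inducedOuterMeasure (fun x (_ : x ∈ loebAlgebra w) => loebContent w x)
          hS.empty_mem addContent_empty).caratheodory :=
      fun s hs => AddContent.isCaratheodory_inducedOuterMeasure hS (loebContent w) s hs
    refine (trim_measurableSet_eq hm hE).trans ?_
    rw [AddContent.measureCaratheodory_eq_inducedOuterMeasure]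
    exact OuterMeasure.ofFunction_eq_iInf_mem (P := (· ∈ loebAlgebra w))
      (extend fun x (_ : x ∈ loebAlgebra w) => loebContent w x) _ (fun s hs => iInf_neg hs) E
  rw [e] at hlt
  simp only [iInf_lt_iff] at hlt
  obtain ⟨B, hB, hEB, hlt⟩ := hlt
  rw [← e] at hlt
  refine ⟨B, hB, hEB, (measure_iUnion_le B).trans (le_of_eq_of_le ?_ hlt.le)⟩
  refine tsum_congr fun k => ?_
  rw [extend_eq _ (hB k)]
  exact (loebContent w).measure_eq hS rfl (loebContent_isSigmaSubadditive hw) (hB k)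

/-- Complements turn an outer cover of `Eᶜ` into an inner approximation of `E`, because `ℬ` is an
algebra. -/
lemma exists_iInter_subset (hw : ¬ IsStandard w) {E : Set (LoebPoint w)} (hE : MeasurableSet E)
    {ε : ℝ≥0∞} (hε : ε ≠ 0) : ∃ B : ℕ → Set (LoebPoint w), (∀ k, B k ∈ loebAlgebra w) ∧
      ⋂ k, B k ⊆ E ∧ baseLoebMeasure w hw (E \ ⋂ k, B k) ≤ ε := by
  obtain ⟨B, hB, hEB, hle⟩ := exists_cover hw hE.compl hε
  refine ⟨fun k => (B k)ᶜ, fun k => (isSetAlgebra_loebAlgebra w).compl_mem (hB k), ?_, ?_⟩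
  · rw [← compl_iUnion]
    exact compl_subset_comm.1 hEB
  · have e : E \ ⋂ k, (B k)ᶜ = (⋃ k, B k) \ Eᶜ := by
      rw [← compl_iUnion, sdiff_compl, sdiff_compl, inter_comm]
    rw [e, measure_sdiff hEB hE.compl.nullMeasurableSet (measure_ne_top _ _)]
    exact tsub_le_iff_left.2 hle

/-- `ℬ` is a compact family. -/
lemma nonempty_iInter_of_mem_loebAlgebra (hw : ¬ IsStandard w) {B : ℕ → Set (LoebPoint w)}
    (hB : ∀ k, B k ∈ loebAlgebra w) (hfin : ∀ K, (⋂ k ∈ Finset.range K, B k).Nonempty) :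
    (⋂ k, B k).Nonempty := by
  choose F hF hBF using fun k =>
    mem_loebAlgebra_iff.1 ((isSetAlgebra_loebAlgebra w).compl_mem (hB k))
  by_contra hne
  -- If the intersection were empty, the complements would cover all of `[Ω]`, and a finite subcover
  -- would contradict `hfin`.
  have hcov : event w (valueAt w timeGrid) ⊆ ⋃ k, event w (valueAt w (F k)) := by
    simp only [← hBF]
    rw [← compl_iInter, not_nonempty_iff_eq_empty.1 hne, compl_empty]
    exact subset_univ _
  obtain ⟨K, hK⟩ := exists_finite_subcover hw (fun n => Subset.rfl) hcov
  obtain ⟨q, hq⟩ := hfin K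
  have hqT : q ∈ event w (valueAt w timeGrid) := q.mem
  obtain ⟨k, hk, hqk⟩ := mem_iUnion₂.1 (hK hqT)
  rw [← hBF k] at hqk
  exact hqk (mem_iInter₂.1 hq k hk)

/-- For `c` in the closure, intersect the `B k` with grid events of balls shrinking to `c`.
Compactness of `ℬ` yields a common point, and its standard part must be `c`. -/
lemma isClosed_image_standardPart (hw : ¬ IsStandard w) {B : ℕ → Set (LoebPoint w)}
    (hB : ∀ k, B k ∈ loebAlgebra w) : IsClosed (standardPart '' ⋂ k, B k) := by
  refine isClosed_of_closure_subset fun c hc => ?_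
  have hne : (⋂ k, B k ∩ gridEvent w (Metric.closedBall c (1 / ((k : ℝ) + 1)))).Nonempty := by
    refine nonempty_iInter_of_mem_loebAlgebra hw
      (fun k => (isSetAlgebra_loebAlgebra w).inter_mem (hB k) (gridEvent_mem_loebAlgebra _))
      fun K => ?_
    -- The balls are nested, so one point with standard part within `1 / (K + 1)` of `c` meets all
    -- conditions `k < K`.
    obtain ⟨_, ⟨q, hq, rfl⟩, hqc⟩ :=
      Metric.mem_closure_iff.1 hc (1 / ((K : ℝ) + 1)) Nat.one_div_pos_of_nat
    refine ⟨q, mem_iInter₂.2 fun k hk => ⟨mem_iInter.1 hq k, ?_⟩⟩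
    have hkK : 1 / ((K : ℝ) + 1) ≤ 1 / ((k : ℝ) + 1) :=
      Nat.one_div_le_one_div (Finset.mem_range.1 hk).le
    have h := mem_gridEvent_of_isOpen (S := Metric.ball c (1 / ((k : ℝ) + 1))) Metric.isOpen_ball
      (q := q) (by rw [Metric.mem_ball, dist_comm]; exact hqc.trans_le hkK)
    exact gridEvent_mono Metric.ball_subset_closedBall h
  obtain ⟨q, hq⟩ := hne
  rw [mem_iInter] at hq
  refine ⟨q, mem_iInter.2 fun k => (hq k).1, ?_⟩
  refine eq_of_forall_dist_le fun ε hε => ?_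
  obtain ⟨k, hk⟩ := exists_nat_one_div_lt hε
  exact (standardPart_mem_of_isClosed Metric.isClosed_closedBall (hq k).2 :
    dist _ _ ≤ _).trans hk.le

/-! ### Comparison with Lebesgue measurability -/

/-- If `•A` is Loeb measurable, then `A` contains a Borel set `S` such that `•S` fills up `•A`. -/
lemma exists_measurableSet_subset (hw : ¬ IsStandard w) {A : Set ℝ}
    (hA : NullMeasurableSet (standardPart (w := w) ⁻¹' A) (baseLoebMeasure w hw)) :
    ∃ S ⊆ A, MeasurableSet S ∧
      baseLoebMeasure w hw (standardPart ⁻¹' A \ standardPart ⁻¹' S) = 0 := by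
  obtain ⟨E, hEA, hE, hEeq⟩ := hA.exists_measurable_subset_ae_eq
  choose B hB hBE hBμ using fun k : ℕ =>
    exists_iInter_subset hw hE (ε := ((k : ℝ≥0∞) + 1)⁻¹) (by simp)
  refine ⟨⋃ k, standardPart '' ⋂ i, B k i, ?_, ?_, ?_⟩
  · exact iUnion_subset fun k => image_subset_iff.2 ((hBE k).trans hEA)
  · exact MeasurableSet.iUnion fun k => (isClosed_image_standardPart hw (hB k)).measurableSet
  · have hle : ∀ k : ℕ, baseLoebMeasure w hw (standardPart ⁻¹' A \
        standardPart ⁻¹' ⋃ k, standardPart '' ⋂ i, B k i) ≤ ((k : ℝ≥0∞) + 1)⁻¹ := by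
      intro k
      refine le_trans ?_ (hBμ k)
      -- Every point of `⋂ i, B k i` has its standard part in the union of images; `•A` is then
      -- exchanged for the a.e. equal set `E`.
      refine (measure_mono (sdiff_subset_sdiff_right ?_)).trans
        (measure_congr (hEeq.symm.diff (ae_eq_refl (⋂ i, B k i)))).le
      exact fun q hq => mem_iUnion.2 ⟨k, q, hq, rfl⟩
    have hlim : Tendsto (fun k : ℕ => ((k : ℝ≥0∞) + 1)⁻¹) atTop (nhds 0) := by
      exact_mod_cast ENNReal.tendsto_inv_nat_nhds_zero.comp (tendsto_add_atTop_nat 1)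
    exact le_antisymm (ge_of_tendsto' hlim hle) zero_le

lemma nullMeasurableSet_of_preimage_standardPart (hw : ¬ IsStandard w) {A : Set ℝ}
    (hA : NullMeasurableSet (standardPart (w := w) ⁻¹' A) (baseLoebMeasure w hw)) :
    NullMeasurableSet A (volume.restrict (Icc (0 : ℝ) 1)) := by
  obtain ⟨S, hSA, hS, hS0⟩ := exists_measurableSet_subset hw hA
  obtain ⟨T, hTA, hT, hT0⟩ := exists_measurableSet_subset hw (A := Aᶜ) hA.compl
  -- Now `S ⊆ A ⊆ Tᶜ` with Borel ends. The gap `Tᶜ \ S` is Borel, so its measure can be computed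
  -- upstairs, where its preimage lies in the two null sets.
  have hnull : volume.restrict (Icc (0 : ℝ) 1) (Tᶜ \ S) = 0 := by
    rw [← (measurePreserving_standardPart hw).measure_preimage
      (hT.compl.diff hS).nullMeasurableSet]
    refine measure_mono_null (fun q hq => ?_) (measure_union_null hS0 hT0)
    by_cases hqA : standardPart q ∈ A
    · exact Or.inl ⟨hqA, hq.2⟩
    · exact Or.inr ⟨hqA, hq.1⟩
  have hAS : volume.restrict (Icc (0 : ℝ) 1) (A \ S) = 0 :=
    measure_mono_null (sdiff_subset_sdiff_left (subset_compl_comm.1 hTA)) hnull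
  rw [← union_sdiff_cancel hSA]
  exact hS.nullMeasurableSet.union (NullMeasurableSet.of_null hAS)

/-- `•A` is Loeb measurable if and only if `A` is Lebesgue measurable. -/
lemma mem_loebSets_shadowPreimage_iff (hw : ¬ IsStandard w) {A : Set ℝ} (hA : A ⊆ Icc 0 1) :
    shadowPreimage w A ∈ loebSets w hw ↔ NullMeasurableSet A volume := by
  rw [shadowPreimage_eq_preimage]
  constructor
  · intro h
    have h' := (nullMeasurableSet_restrict measurableSet_Icc.nullMeasurableSet).1
      (nullMeasurableSet_of_preimage_standardPart hw h)
    rwa [inter_eq_left.2 hA] at h'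
  · intro h
    exact (h.mono_ac Measure.absolutelyContinuous_restrict).preimage
      (measurePreserving_standardPart hw).quasiMeasurePreserving

lemma shadowMeasure_eq_volume (hw : ¬ IsStandard w) {A : Set ℝ} (hA : A ⊆ Icc 0 1)
    (hAm : NullMeasurableSet A volume) : shadowMeasure w hw A = volume A := by
  rw [shadowMeasure, loebMeasure, Measure.completion_apply, shadowPreimage_eq_preimage,
    (measurePreserving_standardPart hw).measure_preimage
      (hAm.mono_ac Measure.absolutelyContinuous_restrict),
    Measure.restrict_apply₀' measurableSet_Icc.nullMeasurableSet, inter_eq_left.2 hA]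

end HyperfiniteLoeb

end

theorem mainTheorem10 {J : Type*} (𝒰 : Ultrafilter J) (w : HyperfiniteLoeb.Star 𝒰 ℕ)
    (hw : ¬ HyperfiniteLoeb.IsStandard w) :
    HyperfiniteLoeb.shadowSets w hw =
        {A : Set ℝ | A ⊆ Set.Icc 0 1 ∧ MeasureTheory.NullMeasurableSet A MeasureTheory.volume} ∧
      ∀ A ∈ HyperfiniteLoeb.shadowSets w hw,
        HyperfiniteLoeb.shadowMeasure w hw A = MeasureTheory.volume A := by
  refine ⟨Set.ext fun A =>
    and_congr_right fun hA => HyperfiniteLoeb.mem_loebSets_shadowPreimage_iff hw hA, ?_⟩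
  intro A hA
  exact HyperfiniteLoeb.shadowMeasure_eq_volume hw hA.1
    ((HyperfiniteLoeb.mem_loebSets_shadowPreimage_iff hw hA.1).1 hA.2)
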